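/- Let $(\mathcal A,\overline{\mathcal P})$ be a polarized $C^*$-algebra: $\mathcal A$ is a unital $C^*$-algebra and $\overline{\mathcal P}\subset\mathcal A$ is a norm-closed commutative subalgebra which generates $\mathcal A$ as a $C^*$-algebra and satisfies $\overline{\mathcal P}\cap\mathcal P=\mathbb C\,\mathbb I$, where $\mathcal P:=\{a^*: a\in\overline{\mathcal P}\}$. Assume that $(\mathcal A,\overline{\mathcal P})$ admits norm normal ordering, i.e. the set of finite sums $\sum_k b_k^*a_k$ with $a_k,b_k\in\overline{\mathcal P}$ is norm-dense in $\mathcal A$. A coherent state is a positive linear functional $\omega$ on $\mathcal A$ of norm one such that $\omega(xa)=\omega(x)\omega(a)$ for all $x\in\mathcal A$, $a\in\overline{\mathcal P}$; let $(\pi_\omega,\mathcal H_\omega,v_\omega)$ denote its GNS representation. Let $\omega$ be a coherent state, and let $M_\omega$ be the set of coherent states $\nu$ whose GNS representation $\pi_\nu$ is unitarily equivalent to $\pi_\omega$, with the weak topology, i.e. the topology of pointwise convergence on $\overline{\mathcal P}$. Then for each $\nu\in M_\omega$ the subspace $[\pi_\omega(\ker\nu\cap\mathcal P)v_\omega]^\perp\subset\mathcal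 H_\omega$ is one-dimensional, so that $$\mathcal K_\omega: M_\omega\to\mathbb{CP}(\mathcal H_\omega),\qquad \mathcal K_\omega(\nu):=[\pi_\omega(\ker\nu\cap\mathcal P)v_\omega]^\perp$$ is well defined, where $\mathbb{CP}(\mathcal H_\omega)$ is the projective space of $\mathcal H_\omega$ with the quotient topology from $\mathcal H_\omega\setminus\{0\}$. Moreover: 1. If $\pi_\omega(\mathcal A)\cap L^0(\mathcal H_\omega)\neq\{0\}$, where $L^0(\mathcal H_\omega)$ denotes the compact operators on $\mathcal H_\omega$, then $\mathcal K_\omega$ is continuous. 2. If $\mathcal A$ is postliminal, i.e. the image of every nonzero irreducible representation of $\mathcal A$ contains all compact operators on the representation space, then $\pi_\omega(\mathcal A)\cap L^0(\mathcal H_\omega)\neq\{0\}$, and consequently $\mathcal K_\omega$ is continuous. -/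

import Mathlib

open scoped ComplexOrder InnerProductSpace

universe u

/-- The quotient topology on the complex projective space `ℂP(H)`, as the quotient of `H \ {0}`. -/
noncomputable instance complexProjectiveTopology (H : Type u) [NormedAddCommGroup H] [InnerProductSpace ℂ H] :
    TopologicalSpace (Projectivization ℂ H) :=
  TopologicalSpace.coinduced (Projectivization.mk' ℂ)
    (inferInstance : TopologicalSpace {v : H // v ≠ 0})

section Polarization

variable {A : Type u} [CStarAlgebra A]

/-- `(A, P)` is a polarized C⋆-algebra: `P` is a commutative norm-closed (i.e. Banach) subalgebra
of the unital C⋆-algebra `A`, it generates `A` as a C⋆-algebra, and the intersection of `P` with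
`{a⋆ | a ∈ P}` is `ℂ 1`. -/
structure IsPolarization (P : Subalgebra ℂ A) : Prop where
  isClosed : IsClosed (P : Set A)
  comm : ∀ a ∈ P, ∀ b ∈ P, a * b = b * a
  generates : (StarAlgebra.adjoin ℂ (P : Set A)).topologicalClosure = ⊤
  inter_star : {a : A | a ∈ P ∧ star a ∈ P} = Set.range (algebraMap ℂ A)

/-- Norm normal ordering: the finite sums `∑ bₖ⋆ aₖ` with `aₖ, bₖ ∈ P` are norm-dense in `A`. -/
def HasNormNormalOrdering (P : Subalgebra ℂ A) : Prop :=
  Dense {x : A | ∃ (N : ℕ) (a b : Fin N → P), x = ∑ k, star (b k : A) * (a k : A)}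

/-- Topological irreducibility of a representation on a nonzero Hilbert space: the only closed
invariant subspaces are `0` and the whole space. -/
def IsIrreducibleRep {H : Type u} [NormedAddCommGroup H] [InnerProductSpace ℂ H]
    [CompleteSpace H] (π : A →⋆ₐ[ℂ] (H →L[ℂ] H)) : Prop :=
  Nontrivial H ∧ ∀ V : Submodule ℂ H, IsClosed (V : Set H) →
    (∀ x : A, ∀ v ∈ V, π x v ∈ V) → V = ⊥ ∨ V = ⊤

/-- `A` is postliminal: the image of every (nonzero) irreducible representation contains all
compact operators. Every irreducible representation of `A` is unitarily equivalent to one on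
a Hilbert space in the universe of `A`. -/
def IsPostliminal (A : Type u) [CStarAlgebra A] : Prop :=
  ∀ (H : Type u) [NormedAddCommGroup H] [InnerProductSpace ℂ H] [CompleteSpace H]
    (π : A →⋆ₐ[ℂ] (H →L[ℂ] H)), IsIrreducibleRep π →
    {T : H →L[ℂ] H | IsCompactOperator T} ⊆ Set.range π

end Polarization

section CoherentStates

variable {A : Type u} [CStarAlgebra A] [PartialOrder A] [StarOrderedRing A]

/-- A coherent state on `(A, P)`: a positive linear functional of norm one (equivalently, since `A`
is unital, with value `1` at `1`) such that `ω (x a) = ω x ω a` for `x ∈ A`, `a ∈ P`. -/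
structure IsCoherentState (P : Subalgebra ℂ A) (ω : A →ₚ[ℂ] ℂ) : Prop where
  map_one : ω 1 = 1
  map_mul : ∀ x : A, ∀ a ∈ P, ω (x * a) = ω x * ω a

/-- The cyclic vector `v_ω = [1]` of the GNS representation. -/
noncomputable def gnsVector (ω : A →ₚ[ℂ] ℂ) : ω.GNS :=
  ((ω.toPreGNS 1 : ω.PreGNS) : ω.GNS)

/-- Unitary equivalence of the GNS representations of `ω` and `ν`. -/
def GNSEquivalent (ω ν : A →ₚ[ℂ] ℂ) : Prop :=
  ∃ U : ω.GNS ≃ₗᵢ[ℂ] ν.GNS, ∀ (x : A) (v : ω.GNS),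
    U (ω.gnsStarAlgHom x v) = ν.gnsStarAlgHom x (U v)

/-- `M_ω`: the class of the coherent states on `(A, P)` that are equivalent to `ω`. -/
def CoherentClass (P : Subalgebra ℂ A) (ω : A →ₚ[ℂ] ℂ) : Type u :=
  {ν : A →ₚ[ℂ] ℂ // IsCoherentState P ν ∧ GNSEquivalent ω ν}

/-- The weak topology on `M_ω`, viewed inside the multiplicative functionals on `P`: the topology
of pointwise convergence on `P`. -/
noncomputable instance coherentClassTopology (P : Subalgebra ℂ A) (ω : A →ₚ[ℂ] ℂ) :
    TopologicalSpace (CoherentClass P ω) :=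
  TopologicalSpace.induced (fun ν (a : P) => ν.1 (a : A))
    (inferInstance : TopologicalSpace (P → ℂ))

/-- The subspace `(π_ω(ker ν ∩ P⋆) v_ω)ᗮ` of the GNS space of `ω`, where `P⋆ = {a⋆ | a ∈ P}`. The
set whose span is taken here is itself a linear subspace. -/
noncomputable def coherentLine (P : Subalgebra ℂ A) (ω ν : A →ₚ[ℂ] ℂ) : Submodule ℂ ω.GNS :=
  (Submodule.span ℂ
    {y : ω.GNS | ∃ x : A, ν x = 0 ∧ star x ∈ P ∧ y = ω.gnsStarAlgHom x (gnsVector ω)})ᗮ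

/-- The map `K_ω : M_ω → ℂP(H_ω)`, sending `ν` to `(π_ω(ker ν ∩ P⋆) v_ω)ᗮ`, given that these
subspaces are indeed one-dimensional. -/
noncomputable def coherentStateMap (P : Subalgebra ℂ A) (ω : A →ₚ[ℂ] ℂ)
    (h : ∀ ν : CoherentClass P ω, Module.finrank ℂ (coherentLine P ω ν.1) = 1) :
    CoherentClass P ω → Projectivization ℂ ω.GNS :=
  fun ν => Projectivization.mk'' (coherentLine P ω ν.1) (h ν)

/-- `π_ω(A) ∩ L⁰(H_ω) ≠ {0}`, where `L⁰` denotes the compact operators. -/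
def GNSMeetsCompacts (ω : A →ₚ[ℂ] ℂ) : Prop :=
  Set.range ω.gnsStarAlgHom ∩ {T : ω.GNS →L[ℂ] ω.GNS | IsCompactOperator T} ≠ {0}

end CoherentStates

open Filter Topology

/-! A coherent state makes its GNS vector v a joint eigenvector of P, so normal ordering makes
π(P⋆)v dense (`IsCoherentState.dense_star`). A vector is therefore determined by its inner products
with the π(b⋆)v; for a joint eigenvector with eigenvalues ν(b) these are ν(b)⟪v, ·⟫, so each such
eigenspace is at most a line. Unitary equivalence supplies a unit eigenvector ξ_ν implementing ν,
and the line it spans is K_ω(ν).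

For continuity, let ν → ν₀ along an ultrafilter. Then ξ_ν converges weakly to some c ξ_{ν₀}, and
norm could be lost only if |c| < 1. A compact π(t) not killing ξ_{ν₀} rules this out: ‖π(t)ξ_ν‖²
tends to |c|²‖π(t)ξ_{ν₀}‖² by compactness, but equals ν(t⋆t) → ν₀(t⋆t) = ‖π(t)ξ_{ν₀}‖². So |c| = 1
and convergence is in norm. Irreducibility provides t, and lets postliminality apply. -/

/-- Pointwise convergence of uniformly Lipschitz functions extends from a dense set. -/
theorem tendsto_of_dense_of_lipschitz {ι E : Type*} [SeminormedAddCommGroup E] {l : Filter ι}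
    {F : ι → E → ℂ} {G : E → ℂ} {C : ℝ} (hF : ∀ i x y, ‖F i x - F i y‖ ≤ C * ‖x - y‖)
    (hG : ∀ x y, ‖G x - G y‖ ≤ C * ‖x - y‖) {D : Set E} (hD : Dense D)
    (h : ∀ x ∈ D, Tendsto (fun i => F i x) l (𝓝 (G x))) (x : E) :
    Tendsto (fun i => F i x) l (𝓝 (G x)) := by
  rw [Metric.tendsto_nhds]
  intro ε hε
  have hC : 0 < |C| + 1 := by positivity
  -- `|C| + 1` keeps the denominator positive, as the sign of `C` is not assumed.
  obtain ⟨y, hy, hxy⟩ := hD.exists_dist_lt x (show 0 < ε / (3 * (|C| + 1)) by positivity)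
  have hb : C * ‖x - y‖ < ε / 3 := by
    rw [dist_eq_norm, lt_div_iff₀ (by positivity)] at hxy
    nlinarith [le_abs_self C, norm_nonneg (x - y)]
  filter_upwards [Metric.tendsto_nhds.1 (h y hy) (ε / 3) (by positivity)] with i hi
  have h1 := hF i x y
  have h2 := hG y x
  rw [norm_sub_rev y x] at h2
  rw [dist_eq_norm] at hi ⊢
  have h3 : F i x - G x = (F i x - F i y) + (F i y - G y) + (G y - G x) := by ring
  rw [h3]
  linarith [norm_add₃_le (a := F i x - F i y) (b := F i y - G y) (c := G y - G x)]

section Representation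

variable {A H : Type*} [CStarAlgebra A] [NormedAddCommGroup H] [InnerProductSpace ℂ H]
  [CompleteSpace H] (π : A →⋆ₐ[ℂ] (H →L[ℂ] H))

theorem rep_one_apply (u : H) : π 1 u = u := by
  rw [map_one, one_apply_eq_self]

theorem rep_mul_apply (x y : A) (u : H) : π (x * y) u = π x (π y u) := by
  rw [map_mul, mul_apply_eq_comp]

theorem inner_rep_star_left (x : A) (u w : H) : ⟪π (star x) u, w⟫_ℂ = ⟪u, π x w⟫_ℂ := by
  rw [map_star, ContinuousLinearMap.star_eq_adjoint, ContinuousLinearMap.adjoint_inner_left]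

theorem inner_rep_star_right (x : A) (u w : H) : ⟪u, π (star x) w⟫_ℂ = ⟪π x u, w⟫_ℂ := by
  rw [← inner_rep_star_left, star_star]

theorem rep_sub_algebraMap_apply (x : A) (c : ℂ) (u : H) :
    π (x - algebraMap ℂ A c) u = π x u - c • u := by
  rw [map_sub, sub_apply, Algebra.algebraMap_eq_smul_one, map_smul, smul_apply, rep_one_apply]

end Representation

/-! ### GNS representation of a state -/

section GNS

variable {A : Type u} [CStarAlgebra A] [PartialOrder A] [StarOrderedRing A]

theorem gnsStarAlgHom_gnsVector (f : A →ₚ[ℂ] ℂ) (x : A) :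
    f.gnsStarAlgHom x (gnsVector f) = ((f.toPreGNS x : f.PreGNS) : f.GNS) := by
  simp [gnsVector]

theorem inner_gnsVector (f : A →ₚ[ℂ] ℂ) (x : A) :
    ⟪gnsVector f, f.gnsStarAlgHom x (gnsVector f)⟫_ℂ = f x := by
  rw [gnsStarAlgHom_gnsVector, gnsVector, UniformSpace.Completion.inner_coe,
    PositiveLinearMap.preGNS_inner_def]
  simp

theorem norm_gnsVector {f : A →ₚ[ℂ] ℂ} (hf : f 1 = 1) : ‖gnsVector f‖ = 1 := by
  have h := inner_gnsVector f 1
  rw [rep_one_apply, inner_self_eq_norm_sq_to_K, hf] at h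
  have h' : ‖gnsVector f‖ ^ 2 = 1 := Complex.ofReal_injective (by simpa using h)
  exact (pow_eq_one_iff_of_nonneg (norm_nonneg _) two_ne_zero).1 h'

theorem dense_range_gnsStarAlgHom_gnsVector (f : A →ₚ[ℂ] ℂ) :
    DenseRange fun x : A => f.gnsStarAlgHom x (gnsVector f) := by
  simp_rw [gnsStarAlgHom_gnsVector]
  exact (UniformSpace.Completion.denseRange_coe (α := f.PreGNS)).comp
    f.toPreGNS.surjective.denseRange (UniformSpace.Completion.continuous_coe _)

theorem norm_apply_le_of_map_one {f : A →ₚ[ℂ] ℂ} (hf : f 1 = 1) (x : A) : ‖f x‖ ≤ ‖x‖ := by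
  have hv := norm_gnsVector hf
  rw [← inner_gnsVector]
  refine (norm_inner_le_norm _ _).trans ?_
  rw [hv, one_mul]
  refine (ContinuousLinearMap.le_opNorm _ _).trans ?_
  rw [hv, mul_one]
  exact NonUnitalStarAlgHom.norm_apply_le f.gnsStarAlgHom x

theorem continuous_gnsStarAlgHom (f : A →ₚ[ℂ] ℂ) : Continuous f.gnsStarAlgHom :=
  AddMonoidHomClass.continuous_of_bound f.gnsStarAlgHom 1
    fun x => by simpa using NonUnitalStarAlgHom.norm_apply_le f.gnsStarAlgHom x

end GNS

/-! ### Coherent vectors and the line they span -/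

section Coherent

variable {A : Type u} [CStarAlgebra A] [PartialOrder A] [StarOrderedRing A]
  {P : Subalgebra ℂ A} {ω ν : A →ₚ[ℂ] ℂ}

/-- With b = a - ω(a), ‖π(b)v‖² = ω(b⋆b) = ω(b⋆)ω(b) = 0. -/
theorem IsCoherentState.apply_gnsVector (hω : IsCoherentState P ω) {a : A} (ha : a ∈ P) :
    ω.gnsStarAlgHom a (gnsVector ω) = ω a • gnsVector ω := by
  have hb : a - algebraMap ℂ A (ω a) ∈ P := P.sub_mem ha (P.algebraMap_mem _)
  have h0 : ω.gnsStarAlgHom (a - algebraMap ℂ A (ω a)) (gnsVector ω) = 0 := by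
    rw [← inner_self_eq_zero (𝕜 := ℂ), ← inner_rep_star_right, ← rep_mul_apply,
      inner_gnsVector, hω.map_mul _ _ hb, map_sub, Algebra.algebraMap_eq_smul_one,
      map_smul, hω.map_one]
    simp
  rwa [rep_sub_algebraMap_apply, sub_eq_zero] at h0

/-- Since π(b⋆a)v = ω(a)π(b⋆)v, normal ordering reduces orthogonality to the cyclic subspace π(A)v
to orthogonality to π(P⋆)v. -/
theorem IsCoherentState.eq_zero_of_inner_eq_zero (hω : IsCoherentState P ω)
    (hord : HasNormNormalOrdering P) {ξ : ω.GNS}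
    (h : ∀ b ∈ P, ⟪ω.gnsStarAlgHom (star b) (gnsVector ω), ξ⟫_ℂ = 0) : ξ = 0 := by
  have hall : ∀ x : A, ⟪ω.gnsStarAlgHom x (gnsVector ω), ξ⟫_ℂ = 0 := by
    have hc : IsClosed {x : A | ⟪ω.gnsStarAlgHom x (gnsVector ω), ξ⟫_ℂ = 0} :=
      isClosed_eq (by have := continuous_gnsStarAlgHom ω; fun_prop) continuous_const
    intro x
    refine closure_minimal ?_ hc (hord x)
    rintro _ ⟨N, a, b, rfl⟩
    simp only [Set.mem_ofPred_eq, map_sum, sum_apply, rep_mul_apply, hω.apply_gnsVector (a _).2, map_smul, sum_inner,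
      inner_smul_left, h _ (b _).2, mul_zero, Finset.sum_const_zero]
  have hz : (fun y : ω.GNS => ⟪y, ξ⟫_ℂ) = fun _ => 0 :=
    (dense_range_gnsStarAlgHom_gnsVector ω).equalizer (by fun_prop) continuous_const
      (funext hall)
  exact inner_self_eq_zero.1 (congrFun hz ξ)

theorem IsCoherentState.dense_star (hω : IsCoherentState P ω) (hord : HasNormNormalOrdering P) :
    Dense {y : ω.GNS | ∃ b ∈ P, y = ω.gnsStarAlgHom (star b) (gnsVector ω)} := by
  let K : Submodule ℂ ω.GNS :=
    { carrier := {y : ω.GNS | ∃ b ∈ P, y = ω.gnsStarAlgHom (star b) (gnsVector ω)}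
      zero_mem' := ⟨0, P.zero_mem, by simp⟩
      add_mem' := by
        rintro _ _ ⟨b, hb, rfl⟩ ⟨c, hc, rfl⟩
        exact ⟨b + c, P.add_mem hb hc, by simp only [star_add, map_add]; rfl⟩
      smul_mem' := by
        rintro z _ ⟨b, hb, rfl⟩
        exact ⟨star z • b, P.smul_mem hb _, by simp only [star_smul, star_star, map_smul]; rfl⟩ }
  refine (Submodule.dense_iff_topologicalClosure_eq_top (s := K)).2 ?_
  rw [Submodule.topologicalClosure_eq_top_iff, Submodule.eq_bot_iff]
  exact fun ξ hξ => hω.eq_zero_of_inner_eq_zero hord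
    fun b hb => (Submodule.mem_orthogonal _ _).1 hξ _ ⟨b, hb, rfl⟩

/-- A unit vector which is a joint eigenvector of `P` and implements the state `ν`. -/
structure IsCoherentVector (P : Subalgebra ℂ A) (ω ν : A →ₚ[ℂ] ℂ) (ξ : ω.GNS) : Prop where
  norm_eq_one : ‖ξ‖ = 1
  apply_eq : ∀ a ∈ P, ω.gnsStarAlgHom a ξ = ν a • ξ
  inner_eq : ∀ x, ⟪ξ, ω.gnsStarAlgHom x ξ⟫_ℂ = ν x

theorem IsCoherentState.isCoherentVector (hω : IsCoherentState P ω) :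
    IsCoherentVector P ω ω (gnsVector ω) :=
  ⟨norm_gnsVector hω.map_one, fun _ ha => hω.apply_gnsVector ha, inner_gnsVector ω⟩

theorem IsCoherentState.exists_isCoherentVector (hν : IsCoherentState P ν)
    (h : GNSEquivalent ω ν) : ∃ ξ, IsCoherentVector P ω ν ξ := by
  obtain ⟨U, hU⟩ := h
  have hv := hν.isCoherentVector
  refine ⟨U.symm (gnsVector ν), ?_, fun a ha => ?_, fun x => ?_⟩
  · rw [LinearIsometryEquiv.norm_map, hv.norm_eq_one]
  · apply U.injective
    rw [hU, map_smul, U.apply_symm_apply, hv.apply_eq a ha]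
  · rw [← U.inner_map_map, hU, U.apply_symm_apply, hv.inner_eq]

namespace IsCoherentVector

variable {ξ : ω.GNS}

theorem ne_zero (hξ : IsCoherentVector P ω ν ξ) : ξ ≠ 0 := by
  rintro rfl
  simpa using hξ.norm_eq_one

theorem inner_star_gnsVector (hξ : IsCoherentVector P ω ν ξ) {b : A} (hb : b ∈ P) :
    ⟪ω.gnsStarAlgHom (star b) (gnsVector ω), ξ⟫_ℂ = ν b * ⟪gnsVector ω, ξ⟫_ℂ := by
  rw [inner_rep_star_left, hξ.apply_eq b hb, inner_smul_right]

theorem inner_gnsVector_ne_zero (hξ : IsCoherentVector P ω ν ξ) (hω : IsCoherentState P ω)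
    (hord : HasNormNormalOrdering P) : ⟪gnsVector ω, ξ⟫_ℂ ≠ 0 := fun h =>
  hξ.ne_zero <| hω.eq_zero_of_inner_eq_zero hord fun b hb => by
    rw [hξ.inner_star_gnsVector hb, h, mul_zero]

theorem norm_apply_sq (hξ : IsCoherentVector P ω ν ξ) (x : A) :
    ((‖ω.gnsStarAlgHom x ξ‖ : ℂ)) ^ 2 = ν (star x * x) := by
  rw [← hξ.inner_eq, rep_mul_apply, inner_rep_star_right,
    inner_self_eq_norm_sq_to_K]
  rfl

/-- Every common eigenvector of `P` is determined by its eigenvalues up to a scalar. -/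
theorem eq_smul_of_inner_star (hξ : IsCoherentVector P ω ν ξ) (hω : IsCoherentState P ω)
    (hord : HasNormNormalOrdering P) {w : ω.GNS}
    (hw : ∀ b ∈ P, ⟪ω.gnsStarAlgHom (star b) (gnsVector ω), w⟫_ℂ = ν b * ⟪gnsVector ω, w⟫_ℂ) :
    w = (⟪gnsVector ω, w⟫_ℂ / ⟪gnsVector ω, ξ⟫_ℂ) • ξ := by
  have hne := hξ.inner_gnsVector_ne_zero hω hord
  -- The coefficient makes both sides agree against v, hence, by the eigenvalue relations, against
  -- every π(b⋆)v.
  rw [← sub_eq_zero]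
  refine hω.eq_zero_of_inner_eq_zero hord fun b hb => ?_
  rw [inner_sub_right, inner_smul_right, hw b hb, hξ.inner_star_gnsVector hb]
  field_simp
  ring

theorem coherentLine_eq (hξ : IsCoherentVector P ω ν ξ) (hω : IsCoherentState P ω)
    (hν : IsCoherentState P ν) (hord : HasNormNormalOrdering P) :
    coherentLine P ω ν = ℂ ∙ ξ := by
  have hstar : ∀ b, ν (star b) = star (ν b) := fun b => map_star ν b
  apply le_antisymm
  · intro w hw
    have hw' : ∀ x : A, ν x = 0 → star x ∈ P →
        ⟪ω.gnsStarAlgHom x (gnsVector ω), w⟫_ℂ = 0 := fun x h1 h2 =>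
      (Submodule.mem_orthogonal _ _).1 hw _ (Submodule.subset_span ⟨x, h1, h2, rfl⟩)
    rw [hξ.eq_smul_of_inner_star hω hord (w := w) fun b hb => ?_]
    · exact Submodule.smul_mem _ _ (Submodule.mem_span_singleton_self ξ)
    -- The element (b - ν(b))⋆ lies in ker ν ∩ P⋆; orthogonality to it is exactly the eigenvalue
    -- relation for b.
    · have := hw' (star (b - algebraMap ℂ A (ν b)))
        (by
          rw [hstar, map_sub, Algebra.algebraMap_eq_smul_one, map_smul, hν.map_one]
          simp)
        (by
          rw [star_star]
          exact P.sub_mem hb (P.algebraMap_mem _))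
      rwa [inner_rep_star_left, rep_sub_algebraMap_apply, inner_sub_right, inner_smul_right,
        sub_eq_zero, ← inner_rep_star_left] at this
  · rw [Submodule.span_singleton_le_iff_mem]
    refine (Submodule.mem_orthogonal _ _).2 fun u hu => ?_
    induction hu using Submodule.span_induction with
    | mem u hu =>
      obtain ⟨x, h1, h2, rfl⟩ := hu
      have h3 : ν (star x) = 0 := by rw [hstar, h1, star_zero]
      have := hξ.inner_star_gnsVector h2
      rwa [star_star, h3, zero_mul] at this
    | zero => simp
    | add u w _ _ hu hw => rw [inner_add_left, hu, hw, add_zero]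
    | smul c u _ hu => rw [inner_smul_left, hu, mul_zero]

end IsCoherentVector

/-! ### Irreducibility and compact operators -/

/-- The GNS representation of a coherent state is irreducible. -/
theorem IsCoherentState.isIrreducibleRep (hω : IsCoherentState P ω)
    (hord : HasNormNormalOrdering P) : IsIrreducibleRep ω.gnsStarAlgHom := by
  have hv := hω.isCoherentVector
  refine ⟨⟨gnsVector ω, 0, hv.ne_zero⟩, fun V hVc hV => ?_⟩
  have : CompleteSpace V := hVc.completeSpace_coe
  have hVo : ∀ x : A, ∀ w ∈ Vᗮ, ω.gnsStarAlgHom x w ∈ Vᗮ := fun x w hw =>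
    (Submodule.mem_orthogonal _ _).2 fun u hu => by
      rw [← inner_rep_star_left]
      exact (Submodule.mem_orthogonal _ _).1 hw _ (hV _ _ hu)
  have key : ∀ W : Submodule ℂ ω.GNS, IsClosed (W : Set ω.GNS) →
      (∀ x : A, ∀ w ∈ W, ω.gnsStarAlgHom x w ∈ W) → gnsVector ω ∈ W → W = ⊤ := by
    intro W hWc hW hvW
    rw [← hWc.submodule_topologicalClosure_eq, ← Submodule.dense_iff_topologicalClosure_eq_top]
    refine (dense_range_gnsStarAlgHom_gnsVector ω).mono ?_
    rintro _ ⟨x, rfl⟩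
    exact hW x _ hvW
  -- V and its complement are both invariant, so the projection onto V commutes with π. The
  -- projection of v is then an eigenvector with the eigenvalues of v, hence a multiple of v.
  have hmul : ∀ b ∈ P, ω.gnsStarAlgHom b (V.starProjection (gnsVector ω)) =
      ω b • V.starProjection (gnsVector ω) := by
    intro b hb
    have h1 := hω.apply_gnsVector hb
    rw [← map_smul, ← h1]
    symm
    refine Submodule.eq_starProjection_of_mem_of_inner_eq_zero
      (hV _ _ (V.starProjection_apply_mem _)) fun w hw => ?_
    rw [← map_sub]
    exact Submodule.inner_left_of_mem_orthogonal hw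
      (hVo _ _ (V.sub_starProjection_mem_orthogonal _))
  have hc := hv.eq_smul_of_inner_star hω hord (w := V.starProjection (gnsVector ω))
    fun b hb => by rw [inner_rep_star_left, hmul b hb, inner_smul_right]
  set c := ⟪gnsVector ω, V.starProjection (gnsVector ω)⟫_ℂ / ⟪gnsVector ω, gnsVector ω⟫_ℂ
  by_cases hc0 : c = 0
  · left
    rw [hc0, zero_smul] at hc
    have := key Vᗮ V.isClosed_orthogonal hVo (by
      simpa [hc] using V.sub_starProjection_mem_orthogonal (gnsVector ω))
    rwa [Submodule.orthogonal_eq_top_iff] at this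
  · right
    refine key V hVc hV ?_
    rw [← inv_smul_smul₀ hc0 (gnsVector ω), ← hc]
    exact V.smul_mem _ (V.starProjection_apply_mem _)

theorem isCompactOperator_rankOne {H : Type*} [NormedAddCommGroup H] [InnerProductSpace ℂ H]
    (u w : H) : IsCompactOperator (InnerProductSpace.rankOne ℂ u w) :=
  (isCompactOperator_of_locallyCompactSpace_rng
    (ContinuousLinearMap.toSpanSingleton ℂ u)).comp_clm (innerSL ℂ w)

theorem IsPostliminal.gnsMeetsCompacts (hA : IsPostliminal A) (hω : IsCoherentState P ω)
    (hord : HasNormNormalOrdering P) : GNSMeetsCompacts ω := by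
  intro h
  have hK := isCompactOperator_rankOne (gnsVector ω) (gnsVector ω)
  have h0 : InnerProductSpace.rankOne ℂ (gnsVector ω) (gnsVector ω) ∈
      Set.range ω.gnsStarAlgHom ∩ {T : ω.GNS →L[ℂ] ω.GNS | IsCompactOperator T} :=
    ⟨hA ω.GNS _ (hω.isIrreducibleRep hord) hK, hK⟩
  rw [h, Set.mem_singleton_iff, ← norm_eq_zero, InnerProductSpace.norm_rankOne,
    norm_gnsVector hω.map_one] at h0
  norm_num at h0

theorem GNSMeetsCompacts.exists_ne_zero (h : GNSMeetsCompacts ω) :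
    ∃ t : A, IsCompactOperator (ω.gnsStarAlgHom t) ∧ ω.gnsStarAlgHom t ≠ 0 := by
  by_contra! hc
  refine h (Set.Subset.antisymm ?_ ?_)
  · rintro _ ⟨⟨t, rfl⟩, ht⟩
    exact hc t ht
  · rintro _ rfl
    exact ⟨⟨0, map_zero _⟩, isCompactOperator_zero⟩

/-- In an irreducible GNS representation with a nonzero compact operator in its image, some
compact operator in the image does not vanish at a given nonzero vector. -/
theorem GNSMeetsCompacts.exists_apply_ne_zero (h : GNSMeetsCompacts ω)
    (hirr : IsIrreducibleRep ω.gnsStarAlgHom) {ξ : ω.GNS} (hξ : ξ ≠ 0) :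
    ∃ t : A, IsCompactOperator (ω.gnsStarAlgHom t) ∧ ω.gnsStarAlgHom t ξ ≠ 0 := by
  obtain ⟨t, htc, ht0⟩ := h.exists_ne_zero
  by_contra! hc
  -- The vectors killed by every π(ty) form a closed invariant subspace. If all compact π(s) killed
  -- ξ, it would contain ξ, hence be everything, and y = 1 would give π(t) = 0.
  let V : Submodule ℂ ω.GNS := ⨅ y : A, (ω.gnsStarAlgHom (t * y)).ker
  have hmem : ∀ w, w ∈ V ↔ ∀ y, ω.gnsStarAlgHom (t * y) w = 0 := fun w => by simp [V]
  have hVc : IsClosed (V : Set ω.GNS) := by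
    have : (V : Set ω.GNS) = ⋂ y, {w | ω.gnsStarAlgHom (t * y) w = 0} := by
      ext w
      simp only [SetLike.mem_coe, hmem, Set.mem_iInter, Set.mem_ofPred_eq]
    rw [this]
    exact isClosed_iInter fun y => isClosed_eq (by fun_prop) continuous_const
  rcases hirr.2 V hVc fun x w hw => (hmem _).2 fun y => by
    rw [← rep_mul_apply, mul_assoc]
    exact (hmem w).1 hw _ with hV | hV
  · have : ξ ∈ V := (hmem ξ).2 fun y => hc _ (by
      rw [map_mul]
      exact htc.comp_clm (ω.gnsStarAlgHom y))
    rw [hV] at this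
    exact hξ ((Submodule.mem_bot ℂ).1 this)
  · refine ht0 (ContinuousLinearMap.ext fun w => ?_)
    have : w ∈ V := hV ▸ Submodule.mem_top
    simpa using (hmem w).1 this 1

/-! ### Weak and norm convergence of coherent vectors -/

/-- On normally ordered sums ν is Σ conj(ν(bₖ)) ν(aₖ), a continuous function of its values on P;
states are 1-Lipschitz, so density gives the rest. -/
theorem CoherentClass.tendsto_apply (hord : HasNormNormalOrdering P)
    (ν₀ : CoherentClass P ω) (x : A) :
    Tendsto (fun ν : CoherentClass P ω => ν.1 x) (𝓝 ν₀) (𝓝 (ν₀.1 x)) := by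
  have hP : ∀ a ∈ P, Tendsto (fun ν : CoherentClass P ω => ν.1 a) (𝓝 ν₀) (𝓝 (ν₀.1 a)) := by
    intro a ha
    have hc : Continuous fun (ν : CoherentClass P ω) (a : P) => ν.1 (a : A) :=
      continuous_induced_dom
    exact ((continuous_apply (⟨a, ha⟩ : P)).comp hc).tendsto ν₀
  have hlip : ∀ (ν : CoherentClass P ω) (x y : A), ‖ν.1 x - ν.1 y‖ ≤ 1 * ‖x - y‖ := by
    intro ν x y
    rw [one_mul, ← map_sub]
    exact norm_apply_le_of_map_one ν.2.1.map_one _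
  refine tendsto_of_dense_of_lipschitz (F := fun (ν : CoherentClass P ω) x => ν.1 x)
    hlip (hlip ν₀) hord ?_ x
  rintro _ ⟨N, a, b, rfl⟩
  have hexp : ∀ ν : CoherentClass P ω, ν.1 (∑ k, star (b k : A) * (a k : A)) =
      ∑ k, star (ν.1 (b k : A)) * ν.1 (a k : A) := fun ν => by
    rw [map_sum]
    refine Finset.sum_congr rfl fun k _ => ?_
    rw [ν.2.1.map_mul _ _ (a k).2, map_star ν.1]
  simp_rw [hexp]
  exact tendsto_finsetSum _ fun k _ => (hP _ (b k).2).star.mul (hP _ (a k).2)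

/-- Along an ultrafilter, coherent vectors converge weakly to a multiple of the coherent vector
of the limit. -/
theorem exists_tendsto_inner_coherentVector (hω : IsCoherentState P ω)
    (hord : HasNormNormalOrdering P) {ξ : CoherentClass P ω → ω.GNS}
    (hξ : ∀ ν, IsCoherentVector P ω ν.1 (ξ ν)) {ν₀ : CoherentClass P ω}
    {l : Ultrafilter (CoherentClass P ω)} (hl : ↑l ≤ 𝓝 ν₀) :
    ∃ c : ℂ, ∀ y : ω.GNS, Tendsto (fun ν => ⟪y, ξ ν⟫_ℂ) l (𝓝 ⟪y, c • ξ ν₀⟫_ℂ) := by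
  have hball : ∀ ν, ⟪gnsVector ω, ξ ν⟫_ℂ ∈ Metric.closedBall (0 : ℂ) 1 := fun ν => by
    rw [mem_closedBall_zero_iff]
    refine (norm_inner_le_norm _ _).trans ?_
    rw [norm_gnsVector hω.map_one, (hξ ν).norm_eq_one, one_mul]
  obtain ⟨d, -, hd⟩ := (isCompact_closedBall (0 : ℂ) 1).ultrafilter_le_nhds
    (l.map fun ν => ⟪gnsVector ω, ξ ν⟫_ℂ)
    (le_principal_iff.2 (Filter.mem_map.2 (Filter.univ_mem' hball)))
  have hd : Tendsto (fun ν => ⟪gnsVector ω, ξ ν⟫_ℂ) l (𝓝 d) := hd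
  have hne := (hξ ν₀).inner_gnsVector_ne_zero hω hord
  -- Testing the weak limit against y = v forces this value of c.
  set c := d / ⟪gnsVector ω, ξ ν₀⟫_ℂ with hc
  refine ⟨c, fun y => ?_⟩
  have hlip : ∀ (w : ω.GNS), ‖w‖ ≤ 1 + ‖c‖ → ∀ x y : ω.GNS,
      ‖⟪x, w⟫_ℂ - ⟪y, w⟫_ℂ‖ ≤ (1 + ‖c‖) * ‖x - y‖ := by
    intro w hw x y
    rw [← inner_sub_left, mul_comm]
    exact (norm_inner_le_norm _ _).trans (by gcongr)
  refine tendsto_of_dense_of_lipschitz (F := fun ν y => ⟪y, ξ ν⟫_ℂ)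
    (G := fun y => ⟪y, c • ξ ν₀⟫_ℂ)
    (fun ν => hlip _ ?_) (hlip _ ?_) (hω.dense_star hord) ?_ y
  · rw [(hξ ν).norm_eq_one]
    linarith [norm_nonneg c]
  · rw [norm_smul, (hξ ν₀).norm_eq_one]
    linarith
  · rintro _ ⟨b, hb, rfl⟩
    have hlim : ⟪ω.gnsStarAlgHom (star b) (gnsVector ω), c • ξ ν₀⟫_ℂ = ν₀.1 b * d := by
      rw [inner_smul_right, (hξ ν₀).inner_star_gnsVector hb, hc]
      field_simp
    rw [hlim]
    simp_rw [(hξ _).inner_star_gnsVector hb]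
    exact ((CoherentClass.tendsto_apply hord ν₀ b).mono_left hl).mul hd

/-- A compact operator turns weak convergence of unit vectors along an ultrafilter into norm
convergence. -/
theorem IsCompactOperator.tendsto_of_tendsto_inner {ι H : Type*} [NormedAddCommGroup H]
    [InnerProductSpace ℂ H] [CompleteSpace H] {T : H →L[ℂ] H} (hT : IsCompactOperator T)
    {l : Ultrafilter ι} {ξ : ι → H} {η : H} (hξ : ∀ i, ‖ξ i‖ = 1)
    (h : ∀ y : H, Tendsto (fun i => ⟪y, ξ i⟫_ℂ) l (𝓝 ⟪y, η⟫_ℂ)) :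
    Tendsto (fun i => T (ξ i)) l (𝓝 (T η)) := by
  obtain ⟨K, hK, hTK⟩ :=
    IsCompactOperator.image_closedBall_subset_compact (f := T.toLinearMap) hT 1
  obtain ⟨ζ, -, hζ⟩ := hK.ultrafilter_le_nhds (l.map fun i => T (ξ i))
    (le_principal_iff.2 (Filter.mem_map.2 (Filter.univ_mem' fun i =>
      hTK ⟨ξ i, by simp [hξ i], rfl⟩)))
  have hζ : Tendsto (fun i => T (ξ i)) l (𝓝 ζ) := hζ
  suffices ζ = T η by rwa [← this]
  -- The norm limit is also the weak limit, and moving T to its adjoint identifies the latter as T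
  -- η.
  refine ext_inner_left ℂ fun y => tendsto_nhds_unique (tendsto_const_nhds.inner hζ) ?_
  have := h (ContinuousLinearMap.adjoint T y)
  simpa only [ContinuousLinearMap.adjoint_inner_left] using this

/-- For unit vectors, ‖ξ - η‖² = 2 - 2 Re⟪η, ξ⟫. -/
theorem tendsto_of_tendsto_inner_of_norm_eq_one {ι H : Type*} [NormedAddCommGroup H]
    [InnerProductSpace ℂ H] {l : Filter ι} {ξ : ι → H} {η : H} (hξ : ∀ i, ‖ξ i‖ = 1)
    (hη : ‖η‖ = 1) (h : Tendsto (fun i => ⟪η, ξ i⟫_ℂ) l (𝓝 ⟪η, η⟫_ℂ)) :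
    Tendsto ξ l (𝓝 η) := by
  rw [tendsto_iff_norm_sub_tendsto_zero]
  have hsq : Tendsto (fun i => ‖ξ i - η‖ ^ 2) l (𝓝 0) := by
    have h1 : ∀ i, ‖ξ i - η‖ ^ 2 = 2 - 2 * (⟪η, ξ i⟫_ℂ).re := fun i => by
      rw [norm_sub_rev, @norm_sub_sq ℂ, hξ, hη]
      simp only [RCLike.re_to_complex]
      ring
    simp_rw [h1]
    have h2 := ((Complex.continuous_re.tendsto _).comp h).const_mul 2 |>.const_sub 2
    have h3 : (⟪η, η⟫_ℂ).re = 1 := by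
      rw [inner_self_eq_norm_sq_to_K, hη]
      simp
    rw [h3] at h2
    simpa only [mul_one, sub_self, Function.comp_apply] using h2
  have := (Real.continuous_sqrt.tendsto _).comp hsq
  simpa [Function.comp_def, Real.sqrt_sq] using this

theorem IsCoherentState.tendsto_coherentVector (hω : IsCoherentState P ω)
    (hord : HasNormNormalOrdering P) (hcpt : GNSMeetsCompacts ω)
    {ξ : CoherentClass P ω → ω.GNS} (hξ : ∀ ν, IsCoherentVector P ω ν.1 (ξ ν))
    {ν₀ : CoherentClass P ω} {l : Ultrafilter (CoherentClass P ω)} (hl : ↑l ≤ 𝓝 ν₀) :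
    ∃ c : ℂ, c ≠ 0 ∧ Tendsto ξ l (𝓝 (c • ξ ν₀)) := by
  obtain ⟨c, hc⟩ := exists_tendsto_inner_coherentVector hω hord hξ hl
  obtain ⟨t, htc, ht⟩ := hcpt.exists_apply_ne_zero (hω.isIrreducibleRep hord) (hξ ν₀).ne_zero
  -- The same limit is computed twice, through compactness and through the state; comparison gives
  -- |c| = 1.
  have h1 : Tendsto (fun ν => ((‖ω.gnsStarAlgHom t (ξ ν)‖ : ℂ)) ^ 2) l
      (𝓝 ((‖ω.gnsStarAlgHom t (c • ξ ν₀)‖ : ℂ) ^ 2)) :=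
    ((Complex.continuous_ofReal.tendsto _).comp
      (htc.tendsto_of_tendsto_inner (fun ν => (hξ ν).norm_eq_one) hc).norm).pow 2
  have h2 : Tendsto (fun ν => ((‖ω.gnsStarAlgHom t (ξ ν)‖ : ℂ)) ^ 2) l
      (𝓝 ((‖ω.gnsStarAlgHom t (ξ ν₀)‖ : ℂ) ^ 2)) := by
    simp_rw [(hξ _).norm_apply_sq]
    exact (CoherentClass.tendsto_apply hord ν₀ _).mono_left hl
  have h3 : ‖ω.gnsStarAlgHom t (c • ξ ν₀)‖ ^ 2 = ‖ω.gnsStarAlgHom t (ξ ν₀)‖ ^ 2 := by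
    exact_mod_cast tendsto_nhds_unique h1 h2
  have hc1 : ‖c‖ = 1 := by
    rw [sq_eq_sq₀ (norm_nonneg _) (norm_nonneg _), map_smul, norm_smul] at h3
    exact (mul_eq_right₀ (norm_ne_zero_iff.2 ht)).1 h3
  refine ⟨c, norm_ne_zero_iff.1 (by simp [hc1]), ?_⟩
  exact tendsto_of_tendsto_inner_of_norm_eq_one (fun ν => (hξ ν).norm_eq_one)
    (by rw [norm_smul, hc1, (hξ ν₀).norm_eq_one, one_mul]) (hc _)

end Coherent

theorem Projectivization.continuous_mk' (H : Type u) [NormedAddCommGroup H]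
    [InnerProductSpace ℂ H] : Continuous (Projectivization.mk' ℂ : {v : H // v ≠ 0} → _) :=
  continuous_coinduced_rng

theorem Projectivization.mk''_eq_mk {K V : Type*} [DivisionRing K] [AddCommGroup V] [Module K V]
    {L : Submodule K V} (h : Module.finrank K L = 1) {v : V} (hv : v ≠ 0) (hL : L = K ∙ v) :
    Projectivization.mk'' L h = Projectivization.mk K v hv :=
  Projectivization.submodule_injective <| by
    rw [Projectivization.submodule_mk'', Projectivization.submodule_mk, hL]

theorem theorem6p1 {A : Type u} [CStarAlgebra A] [PartialOrder A] [StarOrderedRing A]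
    (P : Subalgebra ℂ A) (hP : IsPolarization P) (hord : HasNormNormalOrdering P)
    (ω : A →ₚ[ℂ] ℂ) (hω : IsCoherentState P ω) :
    ∃ h : ∀ ν : CoherentClass P ω, Module.finrank ℂ (coherentLine P ω ν.1) = 1,
      (GNSMeetsCompacts ω → Continuous (coherentStateMap P ω h)) ∧
      (IsPostliminal A → GNSMeetsCompacts ω ∧ Continuous (coherentStateMap P ω h)) := by
  -- The phases of the ξ_ν are arbitrary; the unknown factor c in the limit disappears in projective
  -- space.
  choose ξ hξ using fun ν : CoherentClass P ω => ν.2.1.exists_isCoherentVector ν.2.2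
  have hline := fun ν => (hξ ν).coherentLine_eq hω ν.2.1 hord
  have h : ∀ ν : CoherentClass P ω, Module.finrank ℂ (coherentLine P ω ν.1) = 1 := fun ν => by
    rw [hline ν]
    exact finrank_span_singleton (hξ ν).ne_zero
  have hcont : GNSMeetsCompacts ω → Continuous (coherentStateMap P ω h) := by
    intro hcpt
    have hmap : ∀ ν, coherentStateMap P ω h ν =
        Projectivization.mk' ℂ ⟨ξ ν, (hξ ν).ne_zero⟩ := fun ν =>
      Projectivization.mk''_eq_mk (h ν) (hξ ν).ne_zero (hline ν)
    rw [continuous_iff_ultrafilter]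
    intro ν₀ l hl
    obtain ⟨c, hc0, hc⟩ := hω.tendsto_coherentVector hord hcpt hξ hl
    have hlim : coherentStateMap P ω h ν₀ =
        Projectivization.mk' ℂ ⟨c • ξ ν₀, smul_ne_zero hc0 (hξ ν₀).ne_zero⟩ := by
      rw [hmap, Projectivization.mk'_eq_mk, Projectivization.mk'_eq_mk,
        Projectivization.mk_eq_mk_iff']
      exact ⟨c⁻¹, inv_smul_smul₀ hc0 _⟩
    rw [hlim, funext hmap]
    exact ((Projectivization.continuous_mk' ω.GNS).tendsto _).comp (tendsto_subtype_rng.2 hc)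
  exact ⟨h, hcont, fun hA =>
    ⟨hA.gnsMeetsCompacts hω hord, hcont (hA.gnsMeetsCompacts hω hord)⟩⟩
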